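/- Let $Q$ be a finite quiver (loops and multiple arrows allowed) with vertices $1,\dots,t$. Let $\widetilde Q$ be the quiver obtained from $Q$ by adding a new arrow $\alpha^{\star}:v\to u$ for every arrow $\alpha:u\to v$ of $Q$. An oriented cycle of length $\ell\ge 1$ in a quiver is a closed directed walk $\pi=(\alpha_1,\dots,\alpha_\ell)$, $\alpha_i:v_{i+1}\to v_i$, $v_{\ell+1}=v_1$, in which vertices and arrows may repeat. A Euclidean representation $\mathcal A=(\mathcal A_\alpha,\mathcal U_v)$ of $Q$ assigns to each vertex $v$ a finite-dimensional real inner product space $\mathcal U_v$ and to each arrow $\alpha:u\to v$ a linear map $\mathcal A_\alpha:\mathcal U_u\to\mathcal U_v$; its dimension is $(\dim\mathcal U_1,\dots,\dim\mathcal U_t)$. Two Euclidean representations $(\mathcal A_\alpha,\mathcal U_v)$ and $(\mathcal B_\alpha,\mathcal V_v)$ are isometric if there are linear isometric bijections $\varphi_v:\mathcal U_v\to\mathcal V_v$ with $\varphi_v\mathcal A_\alpha=\mathcal B_\alpha\varphi_u$ for every arrow $\alpha:u\to v$. The representation $\widetilde{\mathcal A}$ of $\widetilde Q$ extends $\mathcal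 A$ by letting $\widetilde{\mathcal A}_{\alpha^\star}$ be the adjoint of $\mathcal A_\alpha$. For an oriented cycle $\pi$ in $\widetilde Q$ put $\operatorname{tr}\widetilde{\mathcal A}(\pi)=\operatorname{tr}(\widetilde{\mathcal A}_{\alpha_1}\cdots\widetilde{\mathcal A}_{\alpha_\ell})$. A real matrix representation $A$ of $Q$ of dimension $(d_1,\dots,d_t)$ assigns to each arrow $\alpha:u\to v$ a real $d_v\times d_u$ matrix $A_\alpha$. Two real matrix representations $A$ and $B$ of the same dimension are real orthogonally isometric if there are real orthogonal matrices $U_1,\dots,U_t$ with $B_\alpha=U_v^{-1}A_\alpha U_u$ for every arrow $\alpha:u\to v$. The extension $\widetilde A$, with $\widetilde A_{\alpha^\star}=A_\alpha^{T}$, and the traces $\operatorname{tr}\widetilde A(\pi)$ are defined as above. (a) Two Euclidean representations $\mathcal A$ and $\mathcal B$ of $Q$ of the same dimension are isometric if and only if $\operatorname{tr}\widetilde{\mathcal A}(\pi)=\operatorname{tr}\widetilde{\mathcal B}(\pi)$ for each oriented cycle $\pi$ in $\widetilde Q$. (b) Two real matrix representations $A$ and $B$ of $Q$ of the same dimension are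 real orthogonally isometric if and only if $\operatorname{tr}\widetilde A(\pi)=\operatorname{tr}\widetilde B(\pi)$ for each oriented cycle $\pi$ in $\widetilde Q$. (c) In (a) and in (b) it suffices to verify the equalities for all oriented cycles $\pi$ of length at most $$\varphi\bigl((r+2)(d_1+\dots+d_t)\bigr).$$ Here $(d_1,\dots,d_t)$ is the common dimension of the two representations; $r$ is the least natural number with $r(r+1)/2\ge\max_{i,j} m_{ij}$, where $m_{ij}$ is the number of arrows from $j$ to $i$ in $Q$; and $\varphi$ is any real-valued bound for the sufficient word length in Specht's criterion, that is, any function such that for every $n\ge 2$ two complex $n\times n$ matrices $X,Y$ are unitarily similar whenever $\operatorname{tr}w(X,X^*)=\operatorname{tr}w(Y,Y^*)$ for all words $w$ of length at most $\varphi(n)$ in two noncommuting variables. -/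

import Mathlib

universe u w x y

/-- An oriented cycle of a quiver: a closed directed walk with at least one arrow, in which
vertices and arrows may repeat. -/
structure OrientedCycle (V : Type u) [Quiver.{w + 1} V] where
  /-- the initial vertex -/
  base : V
  /-- the closed walk -/
  walk : Quiver.Path base base
  /-- the walk has at least one arrow -/
  length_pos : 0 < walk.length

/-- The number of arrows of an oriented cycle, counted with repetitions. -/
def OrientedCycle.length {V : Type u} [Quiver.{w + 1} V] (π : OrientedCycle V) : ℕ :=
  π.walk.length

/-! ### Euclidean representations -/

/-- A Euclidean representation of a quiver: a Euclidean (finite-dimensional real inner product)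
space for each vertex and a linear map for each arrow. -/
structure EuclideanRep (V : Type u) [Quiver.{w + 1} V] where
  /-- the space at a vertex -/
  space : V → Type x
  [normedAddCommGroup : ∀ v, NormedAddCommGroup (space v)]
  [innerProductSpace : ∀ v, InnerProductSpace ℝ (space v)]
  [finiteDimensional : ∀ v, FiniteDimensional ℝ (space v)]
  /-- the linear map at an arrow -/
  map : ∀ {a b : V}, (a ⟶ b) → (space a →ₗ[ℝ] space b)

namespace EuclideanRep

attribute [instance] normedAddCommGroup innerProductSpace finiteDimensional

/-- The dimension vector of a Euclidean representation. -/
noncomputable def dim {V : Type u} [Quiver.{w + 1} V] (A : EuclideanRep.{u, w, x} V) (v : V) : ℕ :=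
  Module.finrank ℝ (A.space v)

/-- Two Euclidean representations are isometric if there are linear isometric bijections between
the spaces at the vertices that intertwine the linear maps at the arrows. -/
def Isometric {V : Type u} [Quiver.{w + 1} V]
    (A : EuclideanRep.{u, w, x} V) (B : EuclideanRep.{u, w, y} V) : Prop :=
  ∃ φ : ∀ v : V, A.space v ≃ₗᵢ[ℝ] B.space v,
    ∀ (a b : V) (α : a ⟶ b) (z : A.space a), φ b (A.map α z) = B.map α (φ a z)

/-- The linear maps assigned to an arrow `α : a ⟶ b` and to the companion of an arrow
`α : b ⟶ a`: the map `A.map α` and the adjoint of `A.map α`, respectively. -/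
noncomputable def doubleMap {V : Type u} [Quiver.{w + 1} V] (A : EuclideanRep.{u, w, x} V)
    {a b : V} : (a ⟶ b) ⊕ (b ⟶ a) → (A.space a →ₗ[ℝ] A.space b)
  | .inl α => A.map α
  | .inr α => LinearMap.adjoint (A.map α)

/-- The representation of the doubled quiver (each arrow `α : a ⟶ b` gets a new companion arrow
`b ⟶ a`) that extends `A` and assigns to the companion of `α` the adjoint of `A.map α`.
The arrows `a ⟶ b` of `Quiver.Symmetrify V` are the elements of `(a ⟶ b) ⊕ (b ⟶ a)`. -/
noncomputable def double {V : Type u} [Quiver.{w + 1} V] (A : EuclideanRep.{u, w, x} V) :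
    EuclideanRep.{u, w, x} (Quiver.Symmetrify V) where
  space := A.space
  normedAddCommGroup := A.normedAddCommGroup
  innerProductSpace := A.innerProductSpace
  finiteDimensional := A.finiteDimensional
  map := A.doubleMap

/-- The composition of the linear maps along a directed walk. -/
def along {V : Type u} [Quiver.{w + 1} V] (A : EuclideanRep.{u, w, x} V) {a : V} :
    ∀ {b : V}, Quiver.Path a b → (A.space a →ₗ[ℝ] A.space b)
  | _, .nil => LinearMap.id
  | _, .cons p α => A.map α ∘ₗ along A p

/-- The trace of a representation on an oriented cycle. -/
noncomputable def cycleTrace {V : Type u} [Quiver.{w + 1} V] (A : EuclideanRep.{u, w, x} V)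
    (π : OrientedCycle V) : ℝ :=
  LinearMap.trace ℝ (A.space π.base) (A.along π.walk)

end EuclideanRep

/-! ### Real matrix representations -/

/-- A real matrix representation of dimension `d` of a quiver: a real `d b × d a` matrix for each
arrow `a ⟶ b`. -/
structure RealMatrixRep (V : Type u) [Quiver.{w + 1} V] (d : V → ℕ) where
  /-- the matrix at an arrow -/
  mat : ∀ {a b : V}, (a ⟶ b) → Matrix (Fin (d b)) (Fin (d a)) ℝ

namespace RealMatrixRep

/-- Two real matrix representations are real orthogonally isometric if one is obtained from the
other by orthogonal changes of basis at the vertices. -/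
def OrthogonallyIsometric {V : Type u} [Quiver.{w + 1} V] {d : V → ℕ}
    (A B : RealMatrixRep V d) : Prop :=
  ∃ O : ∀ v : V, Matrix (Fin (d v)) (Fin (d v)) ℝ,
    (∀ v : V, O v ∈ Matrix.orthogonalGroup (Fin (d v)) ℝ) ∧
    ∀ (a b : V) (α : a ⟶ b), B.mat α = (O b)⁻¹ * A.mat α * O a

/-- The matrices assigned to an arrow `α : a ⟶ b` and to the companion of an arrow `α : b ⟶ a`:
the matrix `A.mat α` and the transpose of `A.mat α`, respectively. -/
def doubleMat {V : Type u} [Quiver.{w + 1} V] {d : V → ℕ} (A : RealMatrixRep V d) {a b : V} :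
    (a ⟶ b) ⊕ (b ⟶ a) → Matrix (Fin (d b)) (Fin (d a)) ℝ
  | .inl α => A.mat α
  | .inr α => (A.mat α).transpose

/-- The matrix representation of the doubled quiver that extends `A` and assigns to the companion
`b ⟶ a` of an arrow `α : a ⟶ b` the transpose of `A.mat α`. -/
def double {V : Type u} [Quiver.{w + 1} V] {d : V → ℕ} (A : RealMatrixRep V d) :
    RealMatrixRep (Quiver.Symmetrify V) d where
  mat := A.doubleMat

/-- The product of the matrices along a directed walk. -/
def along {V : Type u} [Quiver.{w + 1} V] {d : V → ℕ} (A : RealMatrixRep V d) {a : V} :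
    ∀ {b : V}, Quiver.Path a b → Matrix (Fin (d b)) (Fin (d a)) ℝ
  | _, .nil => 1
  | _, .cons p α => A.mat α * along A p

/-- The trace of a matrix representation on an oriented cycle. -/
def cycleTrace {V : Type u} [Quiver.{w + 1} V] {d : V → ℕ} (A : RealMatrixRep V d)
    (π : OrientedCycle V) : ℝ :=
  (A.along π.walk).trace

end RealMatrixRep

/-! ### Word length in Specht's criterion -/

/-- Word length at most `L` suffices in Specht's criterion for complex `n × n` matrices: `A` and
`B` are unitarily similar as soon as `w(A, A*)` and `w(B, B*)` have the same trace for every word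
`w` of length at most `L` in two noncommuting variables. -/
def SpechtLengthSuffices (n : ℕ) (L : ℝ) : Prop :=
  ∀ A B : Matrix (Fin n) (Fin n) ℂ,
    (∀ s : FreeMonoid (Fin 2), (s.length : ℝ) ≤ L →
      (FreeMonoid.lift ![A, A.conjTranspose] s).trace =
        (FreeMonoid.lift ![B, B.conjTranspose] s).trace) →
    ∃ U ∈ Matrix.unitaryGroup (Fin n) ℂ, B = U⁻¹ * A * U

/-! A representation is packed into one real square matrix in such a way that orthogonal similarity
of the packed matrices forces isometry of the representations. The question then becomes Specht's
criterion for real matrices.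

The packed matrix `encodingMatrix` is block upper triangular with `r + 2` levels, each holding one
block for every vertex. It has pairwise distinct scalars on the diagonal, identities on the
superdiagonal, and the arrows in the `r (r + 1) / 2` positions above. An orthogonal intertwiner of
two such matrices is block diagonal because the scalars differ. Its blocks at a fixed vertex
coincide because of the identities, and the arrow blocks then say that these blocks form an isometry
(`orthogonallyIsometric_of_encodingMatrix`). In the other direction, each block of a word of length
`n` in the packed matrix and its transpose is a combination of walks of length at most `n` in the
doubled quiver. The coefficients do not depend on the representation, so cycle traces determine word
traces (`trace_transposeWord_encodingMatrix_eq`).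

The real Specht criterion `exists_orthogonal_intertwiner` comes from an extremal argument. Among the
partial isometries `W` intertwining `X, Xᵀ` with `Y, Yᵀ`, one with the largest trace of `Wᵀ * W` is
chosen. If it were not orthogonal, word traces would still agree on the complementary projections,
`exists_intertwiner_ne_zero` would give a nonzero intertwiner there, and its polar part could be
added to `W`.

The bound `φ` concerns complex matrices. It serves only to pass from traces of short words to traces
of all words, so unitary and orthogonal similarity need not be compared directly. Euclidean
representations reduce to matrices through orthonormal bases. -/

open Matrix

/-! ### Specht's criterion for real matrices -/

section Specht

variable {n : Type*} [Fintype n] [DecidableEq n]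

/-- The value of a word in two variables at a real matrix and its transpose. -/
def transposeWord (X : Matrix n n ℝ) : FreeMonoid (Fin 2) →* Matrix n n ℝ :=
  FreeMonoid.lift ![X, Xᵀ]

theorem transposeWord_of_zero (X : Matrix n n ℝ) : transposeWord X (FreeMonoid.of 0) = X := by
  simp [transposeWord]

theorem transposeWord_of_one (X : Matrix n n ℝ) : transposeWord X (FreeMonoid.of 1) = Xᵀ := by
  simp [transposeWord]

/-- Reverse the word and swap the two letters. The new word is independent of `X`, so it serves `X`
and `Y` at once. -/
theorem exists_transposeWord_eq_transpose (s : FreeMonoid (Fin 2)) :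
    ∃ s' : FreeMonoid (Fin 2), ∀ X : Matrix n n ℝ, transposeWord X s' = (transposeWord X s)ᵀ := by
  induction s with
  | one => exact ⟨1, fun X => by simp⟩
  | of i =>
    fin_cases i
    · exact ⟨FreeMonoid.of 1, fun X => by simp [transposeWord]⟩
    · exact ⟨FreeMonoid.of 0, fun X => by simp [transposeWord]⟩
  | mul s t hs ht =>
    obtain ⟨s', hs'⟩ := hs
    obtain ⟨t', ht'⟩ := ht
    exact ⟨t' * s', fun X => by simp [hs', ht']⟩

theorem Matrix.trace_transpose_mul_self_eq_zero {m n : Type*} [Fintype m] [Fintype n]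
    {A : Matrix m n ℝ} :
    (Aᵀ * A).trace = 0 ↔ A = 0 := by
  rw [← conjTranspose_eq_transpose_of_trivial, trace_conjTranspose_mul_self_eq_zero_iff]

theorem commute_transposeWord {X P : Matrix n n ℝ} (h : Commute P X) (h' : Commute P Xᵀ)
    (s : FreeMonoid (Fin 2)) : Commute P (transposeWord X s) := by
  induction s with
  | one => simp
  | of i => fin_cases i <;> simpa [transposeWord]
  | mul s t hs ht => rw [map_mul]; exact hs.mul_right ht

/-- The pairs formed by the value of a noncommutative polynomial at a pair of matrices, cut down by
a pair of projections. -/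
def wordSpan (X Y P Q : Matrix n n ℝ) : Submodule ℝ (Matrix n n ℝ × Matrix n n ℝ) :=
  Submodule.span ℝ (Set.range fun s => (transposeWord X s * P, transposeWord Y s * Q))

variable {X Y P Q : Matrix n n ℝ}

theorem trace_eq_of_mem_wordSpan
    (h : ∀ s, (transposeWord X s * P).trace = (transposeWord Y s * Q).trace)
    {e : Matrix n n ℝ × Matrix n n ℝ} (he : e ∈ wordSpan X Y P Q) : e.1.trace = e.2.trace := by
  induction he using Submodule.span_induction with
  | mem e he => obtain ⟨s, rfl⟩ := he; exact h s
  | zero => simp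
  | add e f _ _ he hf => simp [he, hf]
  | smul c e _ he => simp [he]

theorem mul_mem_wordSpan (s : FreeMonoid (Fin 2))
    {e : Matrix n n ℝ × Matrix n n ℝ} (he : e ∈ wordSpan X Y P Q) :
    (transposeWord X s * e.1, transposeWord Y s * e.2) ∈ wordSpan X Y P Q := by
  induction he using Submodule.span_induction with
  | mem e he =>
    obtain ⟨t, rfl⟩ := he
    exact Submodule.subset_span ⟨s * t, by simp [mul_assoc]⟩
  | zero => simp [← Prod.zero_eq_mk]
  | add e f _ _ he hf => simpa [mul_add] using add_mem he hf
  | smul c e _ he => simpa using Submodule.smul_mem _ c he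

theorem mul_fst_of_mem_wordSpan (hP : P * P = P) (hPX : Commute P X) (hPX' : Commute P Xᵀ)
    {e : Matrix n n ℝ × Matrix n n ℝ} (he : e ∈ wordSpan X Y P Q) : P * e.1 = e.1 := by
  induction he using Submodule.span_induction with
  | mem e he =>
    obtain ⟨s, rfl⟩ := he
    simp only
    rw [← mul_assoc, (commute_transposeWord hPX hPX' s).eq, mul_assoc, hP]
  | zero => simp
  | add e f _ _ he hf => simp [he, hf, mul_add]
  | smul c e _ he => simp [he]

theorem mul_snd_of_mem_wordSpan (hQ : Q * Q = Q) (hQY : Commute Q Y) (hQY' : Commute Q Yᵀ)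
    {e : Matrix n n ℝ × Matrix n n ℝ} (he : e ∈ wordSpan X Y P Q) : Q * e.2 = e.2 := by
  induction he using Submodule.span_induction with
  | mem e he =>
    obtain ⟨s, rfl⟩ := he
    simp only
    rw [← mul_assoc, (commute_transposeWord hQY hQY' s).eq, mul_assoc, hQ]
  | zero => simp
  | add e f _ _ he hf => simp [he, hf, mul_add]
  | smul c e _ he => simp [he]

/-- The projections are symmetric, commute with all words and fix the elements of the span, so a
transposed factor acts as left multiplication by the transposed word. This closure turns equality of
traces into equality of the norms `tr (eᵀ e)` of the two components. -/
theorem transpose_mul_mem_wordSpan (hPX : Commute P X) (hPX' : Commute P Xᵀ)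
    (hP : P * P = P) (hPt : Pᵀ = P)
    (hQY : Commute Q Y) (hQY' : Commute Q Yᵀ) (hQ : Q * Q = Q) (hQt : Qᵀ = Q)
    {e f : Matrix n n ℝ × Matrix n n ℝ}
    (he : e ∈ wordSpan X Y P Q) (hf : f ∈ wordSpan X Y P Q) :
    (e.1ᵀ * f.1, e.2ᵀ * f.2) ∈ wordSpan X Y P Q := by
  induction he using Submodule.span_induction with
  | mem e he =>
    obtain ⟨s, rfl⟩ := he
    obtain ⟨s', hs'⟩ := exists_transposeWord_eq_transpose (n := n) s
    convert mul_mem_wordSpan s' hf using 2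
    · simp only [transpose_mul, hPt]
      rw [← hs', (commute_transposeWord hPX hPX' s').eq, mul_assoc,
        mul_fst_of_mem_wordSpan hP hPX hPX' hf]
    · simp only [transpose_mul, hQt]
      rw [← hs', (commute_transposeWord hQY hQY' s').eq, mul_assoc,
        mul_snd_of_mem_wordSpan hQ hQY hQY' hf]
  | zero => simp [← Prod.zero_eq_mk]
  | add e f _ _ he hf => simpa [add_mul] using add_mem he hf
  | smul c e _ he => simpa using Submodule.smul_mem _ c he

/-- The trace form on the first components of a space of pairs of matrices. -/
noncomputable def fstTraceForm (S : Submodule ℝ (Matrix n n ℝ × Matrix n n ℝ)) :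
    LinearMap.BilinForm ℝ S :=
  LinearMap.mk₂ ℝ (fun e f => (e.1.1ᵀ * f.1.1).trace)
    (by intros; simp [add_mul]) (by intros; simp) (by intros; simp [mul_add]) (by intros; simp)

theorem fstTraceForm_apply (S : Submodule ℝ (Matrix n n ℝ × Matrix n n ℝ)) (e f : S) :
    fstTraceForm S e f = (e.1.1ᵀ * f.1.1).trace := rfl

/-- If the polynomials in `X, Xᵀ` and in `Y, Yᵀ` have the same traces on the ranges of two
invariant projections, there is a nonzero intertwiner between these ranges. -/
theorem exists_intertwiner_ne_zero (hPX : Commute P X) (hPX' : Commute P Xᵀ)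
    (hP : P * P = P) (hPt : Pᵀ = P)
    (hQY : Commute Q Y) (hQY' : Commute Q Yᵀ) (hQ : Q * Q = Q) (hQt : Qᵀ = Q)
    (h : ∀ s, (transposeWord X s * P).trace = (transposeWord Y s * Q).trace) (hP0 : P ≠ 0) :
    ∃ T : Matrix n n ℝ, T ≠ 0 ∧ T * X = Y * T ∧ T * Xᵀ = Yᵀ * T ∧ T * P = T ∧ Q * T = T := by
  set S := wordSpan X Y P Q with hS
  -- For a pair `(a, b)` in the span, `tr (aᵀ a) = tr (bᵀ b)`, so either component determines the
  -- other and the trace form is nondegenerate.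
  have key : ∀ e : S, e.1.1 = 0 → e = 0 := by
    rintro ⟨⟨a, b⟩, he⟩ h0
    obtain rfl : a = 0 := h0
    have h1 := trace_eq_of_mem_wordSpan h
      (transpose_mul_mem_wordSpan hPX hPX' hP hPt hQY hQY' hQ hQt he he)
    have hb : b = 0 := trace_transpose_mul_self_eq_zero.1 (by simpa using h1.symm)
    subst hb
    rfl
  have key2 : ∀ e : S, e.1.2 = 0 → e = 0 := by
    intro e h0
    apply key
    have h1 := trace_eq_of_mem_wordSpan h
      (transpose_mul_mem_wordSpan hPX hPX' hP hPt hQY hQY' hQ hQt e.2 e.2)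
    exact trace_transpose_mul_self_eq_zero.1 (by simpa [h0] using h1)
  have hB : (fstTraceForm S).Nondegenerate := by
    constructor
    · intro e he
      exact key e (trace_transpose_mul_self_eq_zero.1 (he e))
    · intro e he
      exact key e (trace_transpose_mul_self_eq_zero.1 (he e))
  let b := Module.finBasis ℝ S
  let f := (fstTraceForm S).dualBasis hB b
  have hf : ∀ z : S, z = ∑ i, fstTraceForm S z (b i) • f i := by
    intro z
    conv_lhs => rw [← f.sum_repr z]
    simp only [f, LinearMap.BilinForm.dualBasis_repr_apply]
  have hb : ∀ z : S, z = ∑ i, fstTraceForm S (f i) z • b i := by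
    intro z
    conv_lhs => rw [← b.sum_repr z]
    refine Finset.sum_congr rfl fun i _ => ?_
    congr 1
    conv_rhs => rw [← b.sum_repr z, map_sum]
    simp only [f, map_smul, LinearMap.BilinForm.apply_dualBasis_left]
    simp
  -- Averaging over dual bases, as with a Casimir element: every `T C` is an intertwiner, whatever
  -- `C` is.
  let T : Matrix n n ℝ → Matrix n n ℝ := fun C => ∑ i, (b i).1.2 * C * (f i).1.1ᵀ
  have hfst : ∀ z : S, z.1.1 = ∑ i, fstTraceForm S z (b i) • (f i).1.1 := by
    intro z
    conv_lhs => rw [hf z]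
    simp [Prod.fst_sum]
  have hsnd : ∀ z : S, z.1.2 = ∑ i, fstTraceForm S (f i) z • (b i).1.2 := by
    intro z
    conv_lhs => rw [hb z]
    simp [Prod.snd_sum]
  have hint : ∀ s C, T C * transposeWord X s = transposeWord Y s * T C := by
    intro s C
    obtain ⟨s', hs'⟩ := exists_transposeWord_eq_transpose (n := n) s
    simp only [T, Finset.sum_mul, Finset.mul_sum]
    have h1 : ∀ i, (b i).1.2 * C * (f i).1.1ᵀ * transposeWord X s =
        ∑ j, fstTraceForm S ⟨_, mul_mem_wordSpan s' (f i).2⟩ (b j) •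
          ((b i).1.2 * C * (f j).1.1ᵀ) := by
      intro i
      have := hfst ⟨_, mul_mem_wordSpan s' (f i).2⟩
      simp only at this
      rw [mul_assoc _ _ (transposeWord X s), ← transpose_transpose (transposeWord X s),
        ← transpose_mul, ← hs']
      refine (congrArg (fun Z => (b i).1.2 * C * Zᵀ) this).trans ?_
      simp [transpose_sum, Finset.mul_sum]
    have h2 : ∀ i, transposeWord Y s * ((b i).1.2 * C * (f i).1.1ᵀ) =
        ∑ j, fstTraceForm S (f j) ⟨_, mul_mem_wordSpan s (b i).2⟩ •
          ((b j).1.2 * C * (f i).1.1ᵀ) := by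
      intro i
      have := hsnd ⟨_, mul_mem_wordSpan s (b i).2⟩
      simp only at this
      rw [← mul_assoc, ← mul_assoc]
      refine (congrArg (fun Z => Z * C * (f i).1.1ᵀ) this).trans ?_
      simp [Finset.sum_mul]
    -- After the sums are exchanged, the coefficients agree because left multiplication by a word
    -- and by its transpose are adjoint for the trace form.
    simp only [h1, h2]
    rw [Finset.sum_comm]
    refine Finset.sum_congr rfl fun i _ => Finset.sum_congr rfl fun j _ => ?_
    congr 1
    simp only [fstTraceForm_apply, transpose_mul, hs', transpose_transpose, mul_assoc]
  -- Vanishing on all matrix units would be a linear relation among the `f i` whose coefficients are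
  -- the entries of `(b i).1.2`. Independence then kills every `b i`, hence also `(P, Q)`, the
  -- element of the empty word.
  have hne : ∃ C, T C ≠ 0 := by
    by_contra! hT
    have hz : ∀ k l, ∑ i, (b i).1.2 k l • f i = 0 := by
      intro k l
      apply key
      ext p q
      have := congrFun (congrFun (hT (Matrix.single l q 1)) k) p
      simp only [T, Matrix.sum_apply, Matrix.mul_apply, Matrix.single_apply,
        Matrix.transpose_apply, Matrix.zero_apply] at this
      simpa [Prod.fst_sum, Matrix.sum_apply, ite_and, Finset.sum_ite_eq] using this
    have hb0 : ∀ i, b i = 0 := by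
      intro i
      apply key2
      ext k l
      exact Fintype.linearIndependent_iff.1 f.linearIndependent _ (hz k l) i
    have hmem : (P, Q) ∈ S := Submodule.subset_span ⟨1, by simp⟩
    have : (⟨(P, Q), hmem⟩ : S) = 0 := by
      rw [← b.sum_repr ⟨(P, Q), hmem⟩]
      simp [hb0]
    exact hP0 (congrArg (fun e : S => e.1.1) this)
  obtain ⟨C, hC⟩ := hne
  refine ⟨T C, hC, ?_, ?_, ?_, ?_⟩
  · simpa [transposeWord] using hint (FreeMonoid.of 0) C
  · simpa [transposeWord] using hint (FreeMonoid.of 1) C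
  · simp only [T, Finset.sum_mul]
    refine Finset.sum_congr rfl fun i _ => ?_
    rw [mul_assoc, ← hPt, ← transpose_mul, mul_fst_of_mem_wordSpan hP hPX hPX' (f i).2]
  · simp only [T, Finset.mul_sum]
    refine Finset.sum_congr rfl fun i _ => ?_
    rw [← mul_assoc, ← mul_assoc, mul_snd_of_mem_wordSpan hQ hQY hQY' (b i).2]

/-- The partial isometry in the polar decomposition of a nonzero real matrix, obtained by
multiplication with a matrix that commutes with everything that commutes with `TᵀT`. -/
theorem exists_mul_isPartialIsometry {T : Matrix n n ℝ} (hT : T ≠ 0) :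
    ∃ R : Matrix n n ℝ, (∀ Z, Commute (Tᵀ * T) Z → Commute R Z) ∧ T * R ≠ 0 ∧
      T * R * (T * R)ᵀ * (T * R) = T * R := by
  have hsa : IsSelfAdjoint (Tᵀ * T) := by
    simp [IsSelfAdjoint, star_eq_conjTranspose]
  set S := Tᵀ * T with hS
  have hpsd : S.PosSemidef := by
    simpa using posSemidef_conjTranspose_mul_self T
  have hnn : ∀ x ∈ spectrum ℝ S, 0 ≤ x := by
    intro x hx
    rw [hpsd.isHermitian.spectrum_real_eq_range_eigenvalues] at hx
    obtain ⟨i, rfl⟩ := hx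
    exact hpsd.eigenvalues_nonneg i
  have hcont : ∀ g : ℝ → ℝ, ContinuousOn g (spectrum ℝ S) :=
    fun g => (Matrix.finite_real_spectrum).continuousOn g
  -- Since `0⁻¹ = 0`, `cfc f S` is the pseudo-inverse of the square root of `S`, vanishing on the
  -- kernel of `T`.
  let f : ℝ → ℝ := fun x => (Real.sqrt x)⁻¹
  have hfs : ∀ x, 0 ≤ x → f x * (x * f x) * x = x := by
    intro x hx
    rcases hx.eq_or_lt with rfl | hx
    · simp
    · have := Real.mul_self_sqrt hx.le
      have h0 := (Real.sqrt_pos.2 hx).ne'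
      simp only [f]
      field_simp
      nlinarith
  have hfs' : ∀ x, 0 ≤ x → f x * (f x * (x * f x)) = f x := by
    intro x hx
    rcases hx.eq_or_lt with rfl | hx
    · simp [f]
    · have := Real.mul_self_sqrt hx.le
      have h0 := (Real.sqrt_pos.2 hx).ne'
      simp only [f]
      field_simp
      nlinarith
  have hid : cfc (fun x : ℝ => x) S = S := cfc_id' ℝ S hsa
  have hR : (cfc f S)ᵀ = cfc f S := by
    have := (cfc_predicate f S : IsSelfAdjoint (cfc f S))
    simpa [IsSelfAdjoint, star_eq_conjTranspose] using this
  have hE : (cfc f S) * (S * cfc f S) = cfc (fun x => f x * (x * f x)) S := by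
    rw [cfc_mul f (fun x => x * f x) S (hcont _) (hcont _),
      cfc_mul (fun x => x) f S (hcont _) (hcont _), hid]
  refine ⟨cfc f S, fun Z hZ => hsa.commute_cfc hZ f, ?_, ?_⟩
  · intro h0
    have h1 : (cfc f S) * (S * cfc f S) = 0 := by
      rw [hS, mul_assoc, ← hS, h0, mul_zero, mul_zero]
    have h2 : cfc (fun x => f x * (x * f x) * x) S = S := by
      conv_rhs => rw [← hid]
      exact cfc_congr fun x hx => hfs x (hnn x hx)
    rw [cfc_mul _ (fun x => x) S (hcont _) (hcont _), ← hE, h1, zero_mul] at h2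
    apply hT
    rw [← trace_transpose_mul_self_eq_zero, ← hS, ← h2, trace_zero]
  · have h2 : cfc f S * (cfc f S * (S * cfc f S)) = cfc f S := by
      rw [hE, ← cfc_mul _ _ S (hcont _) (hcont _)]
      exact cfc_congr fun x hx => hfs' x (hnn x hx)
    calc T * cfc f S * (T * cfc f S)ᵀ * (T * cfc f S)
        = T * (cfc f S * (cfc f S * (S * cfc f S))) := by
          rw [transpose_mul, hR, hS]; simp only [mul_assoc]
      _ = _ := by rw [h2]

/-- The intertwiners from `X` to `Y` that are partial isometries. -/
def partialIsometryIntertwiners {n : Type*} [Fintype n] (X Y : Matrix n n ℝ) : Set (Matrix n n ℝ) :=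
  {W | W * X = Y * W ∧ W * Xᵀ = Yᵀ * W ∧ W * Wᵀ * W = W}

/-- `Wᵀ * W` is a symmetric projection, so a diagonal entry `t` is the sum of the squares of its
column. Hence `t ^ 2 ≤ t`, and `t ≤ 1` bounds each squared entry in that column of `W`. -/
theorem abs_apply_le_one_of_isPartialIsometry {n : Type*} [Fintype n] {W : Matrix n n ℝ}
    (hW : W * Wᵀ * W = W) (i j : n) :
    |W i j| ≤ 1 := by
  have hP : (Wᵀ * W)ᵀ * (Wᵀ * W) = Wᵀ * W := by
    rw [transpose_mul, transpose_transpose, mul_assoc, ← mul_assoc W, hW]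
  have h1 : (Wᵀ * W) j j = ∑ i, (W i j) ^ 2 := by
    simp [Matrix.mul_apply, sq]
  have h2 : (Wᵀ * W) j j = ∑ i, ((Wᵀ * W) i j) ^ 2 := by
    conv_lhs => rw [← hP]
    simp only [Matrix.mul_apply (M := (Wᵀ * W)ᵀ), sq, transpose_apply]
  have h3 : ((Wᵀ * W) j j) ^ 2 ≤ (Wᵀ * W) j j := by
    conv_rhs => rw [h2]
    exact Finset.single_le_sum (f := fun i => ((Wᵀ * W) i j) ^ 2) (fun i _ => sq_nonneg _)
      (Finset.mem_univ j)
  have h4 : (Wᵀ * W) j j ≤ 1 := by nlinarith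
  have h5 : (W i j) ^ 2 ≤ (Wᵀ * W) j j := by
    rw [h1]
    exact Finset.single_le_sum (f := fun i => (W i j) ^ 2) (fun i _ => sq_nonneg _)
      (Finset.mem_univ i)
  rw [← sq_le_one_iff_abs_le_one]
  linarith

theorem isCompact_partialIsometryIntertwiners {n : Type*} [Fintype n] (X Y : Matrix n n ℝ) :
    IsCompact (partialIsometryIntertwiners X Y) := by
  have hK : IsCompact {W : Matrix n n ℝ | ∀ i, W i ∈ {v : n → ℝ | ∀ j, v j ∈ Set.Icc (-1) 1}} :=
    isCompact_pi_infinite fun _ => isCompact_pi_infinite fun _ => isCompact_Icc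
  refine hK.of_isClosed_subset ?_ fun W hW i j =>
    abs_le.1 (abs_apply_le_one_of_isPartialIsometry hW.2.2 i j)
  refine (isClosed_eq ?_ ?_).inter ((isClosed_eq ?_ ?_).inter (isClosed_eq ?_ ?_)) <;> fun_prop

/-- The real form of Specht's criterion. -/
theorem exists_orthogonal_intertwiner {X Y : Matrix n n ℝ}
    (h : ∀ s, (transposeWord X s).trace = (transposeWord Y s).trace) :
    ∃ W : Matrix n n ℝ, Wᵀ * W = 1 ∧ W * X = Y * W := by
  have h0 : (0 : Matrix n n ℝ) ∈ partialIsometryIntertwiners X Y := by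
    simp [partialIsometryIntertwiners]
  obtain ⟨W, ⟨hWX, hWX', hW⟩, hmax⟩ :=
    (isCompact_partialIsometryIntertwiners X Y).exists_isMaxOn ⟨0, h0⟩
      (f := fun W => (Wᵀ * W).trace) (by fun_prop)
  refine ⟨W, ?_, hWX⟩
  by_contra hne
  have hXW : X * Wᵀ = Wᵀ * Y := by
    have := congrArg transpose hWX'
    simp only [transpose_mul, transpose_transpose] at this
    exact this
  have hXW' : Xᵀ * Wᵀ = Wᵀ * Yᵀ := by
    have := congrArg transpose hWX
    simp only [transpose_mul] at this
    exact this
  have hWt : Wᵀ * W * Wᵀ = Wᵀ := by simpa [mul_assoc] using congrArg transpose hW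
  set P := 1 - Wᵀ * W with hPdef
  set Q := 1 - W * Wᵀ with hQdef
  have hWP : W * P = 0 := by rw [hPdef, mul_sub, ← mul_assoc, hW]; simp
  have hWQ : Wᵀ * Q = 0 := by rw [hQdef, mul_sub, ← mul_assoc, hWt]; simp
  have hP : P * P = P := by
    nth_rw 1 [hPdef]
    rw [sub_mul, mul_assoc, hWP]; simp
  have hQ : Q * Q = Q := by
    nth_rw 1 [hQdef]
    rw [sub_mul, mul_assoc, hWQ]; simp
  have hPt : Pᵀ = P := by simp [hPdef]
  have hQt : Qᵀ = Q := by simp [hQdef]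
  have hPX : Commute P X := by
    refine (Commute.one_left X).sub_left ?_
    rw [Commute, SemiconjBy, mul_assoc, hWX, ← mul_assoc, ← hXW, mul_assoc]
  have hPX' : Commute P Xᵀ := by
    refine (Commute.one_left _).sub_left ?_
    rw [Commute, SemiconjBy, mul_assoc, hWX', ← mul_assoc, ← hXW', mul_assoc]
  have hQY : Commute Q Y := by
    refine (Commute.one_left Y).sub_left ?_
    rw [Commute, SemiconjBy, mul_assoc, ← hXW, ← mul_assoc, hWX, mul_assoc]
  have hQY' : Commute Q Yᵀ := by
    refine (Commute.one_left _).sub_left ?_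
    rw [Commute, SemiconjBy, mul_assoc, ← hXW', ← mul_assoc, hWX', mul_assoc]
  have hWs : ∀ s, W * transposeWord X s = transposeWord Y s * W := by
    intro s
    induction s with
    | one => simp
    | of i => fin_cases i <;> simpa [transposeWord]
    | mul s t hs ht => rw [map_mul, map_mul, ← mul_assoc, hs, mul_assoc, ht, mul_assoc]
  -- The subtracted terms agree as well: moving `W` cyclically and through the word carries `Wᵀ * W`
  -- to `W * Wᵀ`.
  have htr : ∀ s, (transposeWord X s * P).trace = (transposeWord Y s * Q).trace := by
    intro s
    rw [hPdef, hQdef, mul_sub, mul_sub, trace_sub, trace_sub, mul_one, mul_one, h s,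
      ← mul_assoc, ← mul_assoc, trace_mul_comm _ W, ← mul_assoc, hWs]
  obtain ⟨T, hT0, hTX, hTX', hTP, hQT⟩ := exists_intertwiner_ne_zero hPX hPX' hP hPt hQY hQY' hQ
    hQt htr (fun h0 => hne (sub_eq_zero.1 h0).symm)
  obtain ⟨R, hR, hTR, hTR'⟩ := exists_mul_isPartialIsometry hT0
  have hPT : P * Tᵀ = Tᵀ := by rw [← hPt, ← transpose_mul, hTP]
  have hXT : X * Tᵀ = Tᵀ * Y := by
    have := congrArg transpose hTX'
    simp only [transpose_mul, transpose_transpose] at this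
    exact this
  have hXT' : Xᵀ * Tᵀ = Tᵀ * Yᵀ := by
    have := congrArg transpose hTX
    simp only [transpose_mul] at this
    exact this
  have hRX : Commute R X := hR X (by
    rw [Commute, SemiconjBy, mul_assoc, hTX, ← mul_assoc, ← hXT, mul_assoc])
  have hRX' : Commute R Xᵀ := hR Xᵀ (by
    rw [Commute, SemiconjBy, mul_assoc, hTX', ← mul_assoc, ← hXT', mul_assoc])
  have hRP : Commute R P := hR P (by
    rw [Commute, SemiconjBy, mul_assoc, hTP, ← mul_assoc, hPT])
  -- `R` commutes with `X`, `Xᵀ` and `P` because they commute with `Tᵀ * T`, so `W'` inherits the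
  -- intertwining relations and the supports of `T`.
  set W' := T * R with hW'
  have hW'P : W' * P = W' := by rw [hW', mul_assoc, hRP.eq, ← mul_assoc, hTP]
  have hPW' : P * W'ᵀ = W'ᵀ := by rw [← hPt, ← transpose_mul, hW'P]
  have e1 : W * W'ᵀ = 0 := by rw [← hPW', ← mul_assoc, hWP, zero_mul]
  have e2 : Wᵀ * W' = 0 := by rw [hW', ← hQT, ← mul_assoc, ← mul_assoc, hWQ]; simp
  have e3 : W' * Wᵀ = 0 := by simpa using congrArg transpose e1
  have e4 : W'ᵀ * W = 0 := by simpa using congrArg transpose e2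
  have hmem : W + W' ∈ partialIsometryIntertwiners X Y := by
    refine ⟨?_, ?_, ?_⟩
    · rw [add_mul, mul_add, hWX, hW', mul_assoc, hRX.eq, ← mul_assoc, hTX, mul_assoc]
    · rw [add_mul, mul_add, hWX', hW', mul_assoc, hRX'.eq, ← mul_assoc, hTX', mul_assoc]
    · have : (W + W') * (W + W')ᵀ = W * Wᵀ + W' * W'ᵀ := by
        rw [transpose_add, add_mul, mul_add, mul_add, e1, e3, add_zero, zero_add]
      rw [this, add_mul, mul_add, mul_add, hW, hTR', mul_assoc, e2, mul_assoc, e4]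
      simp
  -- Initial and final spaces of `W` and `W'` are orthogonal, so the traces add; maximality would
  -- force `W' = 0`.
  have h1 : ((W + W')ᵀ * (W + W')).trace ≤ (Wᵀ * W).trace := hmax hmem
  have h2 : ((W + W')ᵀ * (W + W')).trace = (Wᵀ * W).trace + (W'ᵀ * W').trace := by
    rw [transpose_add, add_mul, mul_add, mul_add, e2, e4]
    simp
  have h3 : 0 ≤ (W'ᵀ * W').trace := by
    simp only [trace, diag, Matrix.mul_apply, transpose_apply]
    exact Finset.sum_nonneg fun i _ => Finset.sum_nonneg fun j _ => mul_self_nonneg _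
  exact hTR (trace_transpose_mul_self_eq_zero.1 (by linarith))

end Specht

/-! ### Isometry as intertwining, and spans of walks of bounded length -/

namespace RealMatrixRep

section Isometry

variable {V : Type u} [Quiver.{w + 1} V] {d : V → ℕ}

theorem orthogonallyIsometric_iff (A B : RealMatrixRep V d) :
    A.OrthogonallyIsometric B ↔ ∃ W : ∀ v : V, Matrix (Fin (d v)) (Fin (d v)) ℝ,
      (∀ v, (W v)ᵀ * W v = 1) ∧ ∀ (a b : V) (α : a ⟶ b), W b * A.mat α = B.mat α * W a := by
  constructor
  · rintro ⟨O, hO, h⟩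
    have hO' : ∀ v, O v * (O v)ᵀ = 1 := fun v => (mem_orthogonalGroup_iff (Fin (d v)) ℝ).1 (hO v)
    refine ⟨fun v => (O v)ᵀ, fun v => by simpa using hO' v, fun a b α => ?_⟩
    rw [h, inv_eq_right_inv (hO' b), Matrix.mul_assoc _ (O a), hO', Matrix.mul_one]
  · rintro ⟨W, hW, h⟩
    have hW' : ∀ v, W v * (W v)ᵀ = 1 := fun v => mul_eq_one_comm.1 (hW v)
    refine ⟨fun v => (W v)ᵀ, fun v => ?_, fun a b α => ?_⟩
    · rw [mem_orthogonalGroup_iff']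
      simpa [star_eq_conjTranspose] using hW' v
    · rw [inv_eq_right_inv (B := W b) (by simpa using hW b), h, Matrix.mul_assoc, hW',
        Matrix.mul_one]

theorem along_comp (A : RealMatrixRep V d) {a b c : V} (p : Quiver.Path a b)
    (q : Quiver.Path b c) : A.along (p.comp q) = A.along q * A.along p := by
  induction q with
  | nil => simp [along]
  | cons q α ih => rw [Quiver.Path.comp_cons, along, along, ih, Matrix.mul_assoc]

theorem mul_along (A B : RealMatrixRep V d) (W : ∀ v : V, Matrix (Fin (d v)) (Fin (d v)) ℝ)
    (h : ∀ (a b : V) (α : a ⟶ b), W b * A.mat α = B.mat α * W a) {a b : V}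
    (p : Quiver.Path a b) : W b * A.along p = B.along p * W a := by
  induction p with
  | nil => simp [along]
  | cons p α ih => rw [along, along, ← Matrix.mul_assoc, h, Matrix.mul_assoc, ih, Matrix.mul_assoc]

theorem cycleTrace_eq_of_intertwiner {A B : RealMatrixRep V d}
    {W : ∀ v : V, Matrix (Fin (d v)) (Fin (d v)) ℝ} (hW : ∀ v, (W v)ᵀ * W v = 1)
    (h : ∀ (a b : V) (α : a ⟶ b), W b * A.mat α = B.mat α * W a) (π : OrientedCycle V) :
    A.cycleTrace π = B.cycleTrace π := by
  have h3 : B.along π.walk = W π.base * A.along π.walk * (W π.base)ᵀ := by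
    rw [mul_along A B W h π.walk, Matrix.mul_assoc, mul_eq_one_comm.1 (hW _), Matrix.mul_one]
  unfold cycleTrace
  rw [h3, trace_mul_cycle, hW, Matrix.one_mul]

/-- This extends an isometry from the arrows to their companions in the doubled quiver. -/
theorem _root_.Matrix.mul_transpose_eq_of_mul_eq {m n : Type*} [Fintype m] [Fintype n]
    [DecidableEq m] [DecidableEq n] {U : Matrix m m ℝ} {W : Matrix n n ℝ} (hU : Uᵀ * U = 1)
    (hW : Wᵀ * W = 1) {M N : Matrix m n ℝ} (h : U * M = N * W) : W * Mᵀ = Nᵀ * U := by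
  have hN : N = U * M * Wᵀ := by rw [h, Matrix.mul_assoc, mul_eq_one_comm.1 hW, Matrix.mul_one]
  rw [hN, transpose_mul, transpose_mul, transpose_transpose, Matrix.mul_assoc, Matrix.mul_assoc,
    hU, Matrix.mul_one]

theorem OrthogonallyIsometric.cycleTrace_double_eq {A B : RealMatrixRep V d}
    (h : A.OrthogonallyIsometric B) (π : OrientedCycle (Quiver.Symmetrify V)) :
    A.double.cycleTrace π = B.double.cycleTrace π := by
  obtain ⟨W, hW, hAB⟩ := (orthogonallyIsometric_iff A B).1 h
  refine cycleTrace_eq_of_intertwiner (V := Quiver.Symmetrify V) (W := W) hW ?_ π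
  rintro a b (α | α)
  · exact hAB a b α
  · exact mul_transpose_eq_of_mul_eq (hW a) (hW b) (hAB b a α)

/-- The span of the pairs of matrices that two representations assign to the walks of length at
most `L` between two vertices. -/
def pathSpan (A B : RealMatrixRep V d) (L : ℕ) (a b : V) :
    Submodule ℝ (Matrix (Fin (d b)) (Fin (d a)) ℝ × Matrix (Fin (d b)) (Fin (d a)) ℝ) :=
  Submodule.span ℝ {e | ∃ p : Quiver.Path a b, p.length ≤ L ∧ e = (A.along p, B.along p)}

variable {A B : RealMatrixRep V d}

theorem along_mem_pathSpan {L : ℕ} {a b : V} (p : Quiver.Path a b) (hp : p.length ≤ L) :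
    (A.along p, B.along p) ∈ pathSpan A B L a b :=
  Submodule.subset_span ⟨p, hp, rfl⟩

theorem one_mem_pathSpan (L : ℕ) (a : V) : (1, 1) ∈ pathSpan A B L a a :=
  along_mem_pathSpan Quiver.Path.nil (Nat.zero_le _)

theorem mat_mem_pathSpan {a b : V} (α : a ⟶ b) : (A.mat α, B.mat α) ∈ pathSpan A B 1 a b := by
  simpa [along, Quiver.Hom.toPath] using
    along_mem_pathSpan (A := A) (B := B) (L := 1) α.toPath le_rfl

theorem mul_mem_pathSpan {L L' : ℕ} {a b c : V}
    {e : Matrix (Fin (d b)) (Fin (d a)) ℝ × Matrix (Fin (d b)) (Fin (d a)) ℝ}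
    {f : Matrix (Fin (d c)) (Fin (d b)) ℝ × Matrix (Fin (d c)) (Fin (d b)) ℝ}
    (he : e ∈ pathSpan A B L a b) (hf : f ∈ pathSpan A B L' b c) :
    (f.1 * e.1, f.2 * e.2) ∈ pathSpan A B (L' + L) a c := by
  induction hf using Submodule.span_induction with
  | mem f hf =>
    obtain ⟨q, hq, rfl⟩ := hf
    induction he using Submodule.span_induction with
    | mem e he =>
      obtain ⟨p, hp, rfl⟩ := he
      simp only [← along_comp]
      exact along_mem_pathSpan _ (by rw [Quiver.Path.length_comp]; omega)
    | zero => simp [← Prod.zero_eq_mk]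
    | add e f _ _ he hf => simpa [Matrix.mul_add] using add_mem he hf
    | smul c e _ he => simpa using Submodule.smul_mem _ c he
  | zero => simp [← Prod.zero_eq_mk]
  | add e f _ _ he hf => simpa [Matrix.add_mul] using add_mem he hf
  | smul c e _ he => simpa using Submodule.smul_mem _ c he

theorem trace_eq_of_mem_pathSpan {L : ℕ} {a : V}
    (h : ∀ π : OrientedCycle V, π.length ≤ L → A.cycleTrace π = B.cycleTrace π)
    {e : Matrix (Fin (d a)) (Fin (d a)) ℝ × Matrix (Fin (d a)) (Fin (d a)) ℝ}
    (he : e ∈ pathSpan A B L a a) : e.1.trace = e.2.trace := by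
  induction he using Submodule.span_induction with
  | mem e he =>
    obtain ⟨p, hp, rfl⟩ := he
    -- The empty walk is not an oriented cycle, but it contributes the same identity matrix on both
    -- sides.
    rcases Nat.eq_zero_or_pos p.length with h0 | h0
    · cases p with
      | nil => rfl
      | cons p α => simp at h0
    · exact h ⟨a, p, h0⟩ hp
  | zero => simp
  | add e f _ _ he hf => simp [he, hf]
  | smul c e _ he => simp [he]

end Isometry

end RealMatrixRep

/-! ### Intertwiners of triangular matrices -/

section Triangular

variable {I : Type*} [Fintype I]

/-- An intertwiner of two triangular matrices with the same diagonal vanishes on and below the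
diagonal outside of the eigenvalue blocks. -/
theorem intertwiner_apply_eq_zero_of_level_le {M M' W : Matrix I I ℝ} {k : I → ℕ} {c : I → ℝ}
    (hc : ∀ p q, c p = c q → k p = k q)
    (hM : ∀ p q, p ≠ q → k q ≤ k p → M p q = 0) (hMd : ∀ p, M p p = c p)
    (hM' : ∀ p q, p ≠ q → k q ≤ k p → M' p q = 0) (hMd' : ∀ p, M' p p = c p)
    (h : W * M = M' * W) (p q : I) (hpq : k q ≤ k p) (hcpq : c p ≠ c q) : W p q = 0 := by
  obtain ⟨K, hK⟩ : ∃ K, ∀ p, k p ≤ K :=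
    ⟨Finset.univ.sup k, fun p => Finset.le_sup (Finset.mem_univ p)⟩
  -- The induction starts at the bottom left corner. Every other term of the two products has a
  -- vanishing factor from `M` or `M'`, or an entry of `W` closer to that corner. What remains is `W
  -- p q * c q = c p * W p q`.
  induction hm : K - k p + k q using Nat.strong_induction_on generalizing p q with
  | _ m ih =>
    have h1 : (W * M) p q = W p q * c q := by
      rw [Matrix.mul_apply, Finset.sum_eq_single q, hMd]
      · intro s _ hs
        rcases le_or_gt (k q) (k s) with hk | hk
        · rw [hM s q hs hk, mul_zero]
        · rw [ih (K - k p + k s) (by omega) p s (by omega)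
            (fun e => by have := hc _ _ e; omega) rfl, zero_mul]
      · simp
    have h2 : (M' * W) p q = c p * W p q := by
      rw [Matrix.mul_apply, Finset.sum_eq_single p, hMd']
      · intro s _ hs
        rcases le_or_gt (k s) (k p) with hk | hk
        · rw [hM' p s hs.symm hk, zero_mul]
        · have := hK s
          rw [ih (K - k s + k q) (by omega) s q (by omega)
            (fun e => by have := hc _ _ e; omega) rfl, mul_zero]
      · simp
    rw [h, h2, mul_comm] at h1
    exact (mul_eq_mul_left_iff.1 h1).resolve_left hcpq

/-- An orthogonal intertwiner of two triangular matrices with the same diagonal is block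
diagonal. -/
theorem orthogonal_intertwiner_apply_eq_zero [DecidableEq I] {M M' W : Matrix I I ℝ} {k : I → ℕ}
    {c : I → ℝ} (hc : ∀ p q, c p = c q → k p = k q)
    (hM : ∀ p q, p ≠ q → k q ≤ k p → M p q = 0) (hMd : ∀ p, M p p = c p)
    (hM' : ∀ p q, p ≠ q → k q ≤ k p → M' p q = 0) (hMd' : ∀ p, M' p p = c p)
    (hW : Wᵀ * W = 1) (h : W * M = M' * W) (p q : I) (hcpq : c p ≠ c q) : W p q = 0 := by
  rcases le_total (k q) (k p) with hk | hk
  · exact intertwiner_apply_eq_zero_of_level_le hc hM hMd hM' hMd' h p q hk hcpq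
  -- Orthogonality makes `Wᵀ` an intertwiner in the opposite direction, which gives the entries
  -- above the diagonal.
  · have h' : Wᵀ * M' = M * Wᵀ := by
      calc Wᵀ * M' = Wᵀ * (M' * W) * Wᵀ := by
            rw [mul_assoc, mul_assoc, mul_eq_one_comm.1 hW, mul_one]
        _ = _ := by rw [← h, ← mul_assoc, hW, one_mul]
    exact intertwiner_apply_eq_zero_of_level_le hc hM' hMd' hM hMd h' q p hk hcpq.symm

end Triangular

/-! ### Encoding a representation in one block triangular matrix -/

section Encoding

variable {V : Type u}

/-- The index set of a square matrix with `r + 2` copies of the blocks at all vertices. -/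
abbrev EncodingIndex (d : V → ℕ) (r : ℕ) : Type u := Fin (r + 2) × (Σ v : V, Fin (d v))

/-- A block of a matrix. -/
def vertexBlock {d : V → ℕ} {r : ℕ} (X : Matrix (EncodingIndex d r) (EncodingIndex d r) ℝ)
    (k : Fin (r + 2)) (v : V) (l : Fin (r + 2)) (u : V) : Matrix (Fin (d v)) (Fin (d u)) ℝ :=
  Matrix.of fun i j => X (k, ⟨v, i⟩) (l, ⟨u, j⟩)

section Blocks

variable [Fintype V] {d : V → ℕ} {r : ℕ}

theorem vertexBlock_mul (X Y : Matrix (EncodingIndex d r) (EncodingIndex d r) ℝ)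
    (k : Fin (r + 2)) (v : V) (l : Fin (r + 2)) (u : V) :
    vertexBlock (X * Y) k v l u =
      ∑ m, ∑ x, vertexBlock X k v m x * vertexBlock Y m x l u := by
  ext i j
  simp [vertexBlock, Matrix.mul_apply, Fintype.sum_prod_type, Fintype.sum_sigma,
    Matrix.sum_apply]

theorem trace_eq_sum_vertexBlock (X : Matrix (EncodingIndex d r) (EncodingIndex d r) ℝ) :
    X.trace = ∑ k, ∑ v, (vertexBlock X k v k v).trace := by
  simp [vertexBlock, Matrix.trace, Fintype.sum_prod_type, Fintype.sum_sigma]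

theorem vertexBlock_mul_of_left [DecidableEq V]
    {W X : Matrix (EncodingIndex d r) (EncodingIndex d r) ℝ}
    (hW : ∀ k v l u, (k, v) ≠ (l, u) → vertexBlock W k v l u = 0)
    (k : Fin (r + 2)) (v : V) (l : Fin (r + 2)) (u : V) :
    vertexBlock (W * X) k v l u = vertexBlock W k v k v * vertexBlock X k v l u := by
  rw [vertexBlock_mul, Finset.sum_eq_single k, Finset.sum_eq_single v]
  · intro x _ hx
    rw [hW k v k x (by simpa using hx.symm), Matrix.zero_mul]
  · simp
  · intro m _ hm
    refine Finset.sum_eq_zero fun x _ => ?_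
    rw [hW k v m x (by simp [hm.symm]), Matrix.zero_mul]
  · simp

theorem vertexBlock_mul_of_right [DecidableEq V]
    {W X : Matrix (EncodingIndex d r) (EncodingIndex d r) ℝ}
    (hW : ∀ k v l u, (k, v) ≠ (l, u) → vertexBlock W k v l u = 0)
    (k : Fin (r + 2)) (v : V) (l : Fin (r + 2)) (u : V) :
    vertexBlock (X * W) k v l u = vertexBlock X k v l u * vertexBlock W l u l u := by
  rw [vertexBlock_mul, Finset.sum_eq_single l, Finset.sum_eq_single u]
  · intro x _ hx
    rw [hW l x l u (by simpa using hx), Matrix.mul_zero]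
  · simp
  · intro m _ hm
    refine Finset.sum_eq_zero fun x _ => ?_
    rw [hW m x l u (by simp [hm]), Matrix.mul_zero]
  · simp

end Blocks

/-- These are the pairs `k < b ≤ r`; with `l = b + 1` they are the positions `k + 1 < l < r + 2`
strictly above the superdiagonal. -/
theorem card_sigma_range (r : ℕ) :
    ((Finset.range (r + 1)).sigma fun b => Finset.range b).card = r * (r + 1) / 2 := by
  rw [Finset.card_sigma]
  simp only [Finset.card_range]
  rw [Finset.sum_range_id, Nat.add_sub_cancel, mul_comm]

/-- The arrows between two vertices can be placed in distinct blocks above the superdiagonal of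
a square array of size `r + 2`. -/
theorem exists_arrow_placement [Quiver.{w + 1} V] [∀ a b : V, Finite (a ⟶ b)] {r : ℕ}
    (hr : ∀ a b : V, Nat.card (a ⟶ b) ≤ r * (r + 1) / 2) :
    ∃ g : ∀ a b : V, ℕ → ℕ → Option (a ⟶ b), ∀ (a b : V) (α : a ⟶ b),
      ∃ k l, k + 1 < l ∧ l < r + 2 ∧ g a b k l = some α := by
  have key : ∀ a b : V, ∃ g : ℕ → ℕ → Option (a ⟶ b), ∀ α : a ⟶ b,
      ∃ k l, k + 1 < l ∧ l < r + 2 ∧ g k l = some α := by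
    intro a b
    have := Fintype.ofFinite (a ⟶ b)
    obtain ⟨e⟩ : Nonempty ((a ⟶ b) ↪ ((Finset.range (r + 1)).sigma fun b => Finset.range b)) := by
      apply Function.Embedding.nonempty_of_card_le
      rw [Fintype.card_coe, card_sigma_range, ← Nat.card_eq_fintype_card]
      exact hr a b
    -- Positions holding no arrow receive `none`, which becomes a zero block in the encoding.
    refine ⟨fun k l => Function.partialInv (fun α => (e α).1) ⟨l - 1, k⟩, fun α => ?_⟩
    have hα := (e α).2
    rw [Finset.mem_sigma, Finset.mem_range, Finset.mem_range] at hα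
    refine ⟨(e α).1.2, (e α).1.1 + 1, by omega, by omega, ?_⟩
    exact Function.Injective.isPartialInv (Subtype.val_injective.comp e.injective) α _ |>.2 rfl
  choose g hg using key
  exact ⟨g, hg⟩

variable [Quiver.{w + 1} V] {d : V → ℕ} {r : ℕ} [DecidableEq V]

/-- The block triangular matrix that encodes a matrix representation: the diagonal blocks are
scalar, the blocks on the superdiagonal are identities, and the arrows are placed above. -/
def encodingMatrix (c : Fin (r + 2) × V → ℝ) (g : ∀ a b : V, ℕ → ℕ → Option (a ⟶ b))
    (A : RealMatrixRep V d) : Matrix (EncodingIndex d r) (EncodingIndex d r) ℝ :=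
  Matrix.of fun p q =>
    if p = q then c (p.1, p.2.1)
    else if (p.1 : ℕ) + 1 = q.1 then (if p.2 = q.2 then 1 else 0)
    else if (p.1 : ℕ) + 1 < q.1 then
      (g q.2.1 p.2.1 p.1 q.1).elim 0 fun α => A.mat α p.2.2 q.2.2
    else 0

variable {c : Fin (r + 2) × V → ℝ} {g : ∀ a b : V, ℕ → ℕ → Option (a ⟶ b)}

theorem encodingMatrix_apply_self (A : RealMatrixRep V d) (p : EncodingIndex d r) :
    encodingMatrix c g A p p = c (p.1, p.2.1) := by
  simp [encodingMatrix]

theorem encodingMatrix_apply_eq_zero (A : RealMatrixRep V d) (p q : EncodingIndex d r)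
    (hpq : p ≠ q) (hk : (q.1 : ℕ) ≤ p.1) : encodingMatrix c g A p q = 0 := by
  rw [encodingMatrix, Matrix.of_apply, if_neg hpq, if_neg (by omega), if_neg (by omega)]

theorem vertexBlock_encodingMatrix_diag (A : RealMatrixRep V d) (k : Fin (r + 2)) (v : V) :
    vertexBlock (encodingMatrix c g A) k v k v = c (k, v) • 1 := by
  ext i j
  by_cases h : i = j <;> simp [vertexBlock, encodingMatrix, h]

theorem vertexBlock_encodingMatrix_of_ne (A : RealMatrixRep V d) (k l : Fin (r + 2)) (v u : V)
    (h : (k : ℕ) + 1 = l ∨ k = l) (hvu : v ≠ u) :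
    vertexBlock (encodingMatrix c g A) k v l u = 0 := by
  ext i j
  have hne : (⟨v, i⟩ : Σ v : V, Fin (d v)) ≠ ⟨u, j⟩ := fun e => hvu (congrArg Sigma.fst e)
  have hne' : ((k, ⟨v, i⟩) : EncodingIndex d r) ≠ (l, ⟨u, j⟩) := fun e => hne (congrArg Prod.snd e)
  rcases h with h | rfl
  · simp [vertexBlock, encodingMatrix, hne, hne', h]
  · simp [vertexBlock, encodingMatrix, hne']

theorem vertexBlock_encodingMatrix_super (A : RealMatrixRep V d) (k l : Fin (r + 2)) (v : V)
    (h : (k : ℕ) + 1 = l) : vertexBlock (encodingMatrix c g A) k v l v = 1 := by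
  ext i j
  have hkl : k ≠ l := by rintro rfl; omega
  by_cases hij : i = j <;> simp [vertexBlock, encodingMatrix, hkl, h, hij, Matrix.one_apply]

theorem vertexBlock_encodingMatrix_upper (A : RealMatrixRep V d) (k l : Fin (r + 2)) (v u : V)
    (h : (k : ℕ) + 1 < l) :
    vertexBlock (encodingMatrix c g A) k v l u = (g u v k l).elim 0 fun α => A.mat α := by
  ext i j
  have hkl : k ≠ l := by rintro rfl; omega
  have hne : (k : ℕ) + 1 ≠ l := h.ne
  simp only [vertexBlock, encodingMatrix, Matrix.of_apply, Prod.mk.injEq, hkl, false_and, hne, h,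
    if_true, if_false]
  cases g u v k l <;> rfl

theorem vertexBlock_encodingMatrix_lower (A : RealMatrixRep V d) (k l : Fin (r + 2)) (v u : V)
    (h : l < k) : vertexBlock (encodingMatrix c g A) k v l u = 0 := by
  ext i j
  refine encodingMatrix_apply_eq_zero A _ _ ?_ ?_
  · intro e
    exact h.ne (congrArg Prod.fst e).symm
  · exact Fin.le_def.1 h.le

/-- The blocks of the encoding matrices of two representations are zero, scalar, or belong to an
arrow. -/
theorem vertexBlock_encodingMatrix_cases (A B : RealMatrixRep V d) (k l : Fin (r + 2)) (v u : V)
    (p : Matrix (Fin (d v)) (Fin (d u)) ℝ × Matrix (Fin (d v)) (Fin (d u)) ℝ → Prop)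
    (h0 : p 0) (h1 : ∀ (h : u = v) (t : ℝ),
      p (h ▸ (t • 1, t • 1) : Matrix (Fin (d v)) (Fin (d u)) ℝ × Matrix (Fin (d v)) (Fin (d u)) ℝ))
    (hα : ∀ α : u ⟶ v, p (A.mat α, B.mat α)) :
    p (vertexBlock (encodingMatrix c g A) k v l u, vertexBlock (encodingMatrix c g B) k v l u) := by
  rcases lt_trichotomy ((k : ℕ) + 1) l with h | h | h
  · rw [vertexBlock_encodingMatrix_upper A k l v u h, vertexBlock_encodingMatrix_upper B k l v u h]
    cases g u v k l with
    | none => exact h0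
    | some α => exact hα α
  · by_cases hvu : v = u
    · subst hvu
      rw [vertexBlock_encodingMatrix_super A k l v h, vertexBlock_encodingMatrix_super B k l v h]
      simpa using h1 rfl 1
    · rw [vertexBlock_encodingMatrix_of_ne A k l v u (Or.inl h) hvu,
        vertexBlock_encodingMatrix_of_ne B k l v u (Or.inl h) hvu]
      exact h0
  · rcases (show l ≤ k from Fin.le_def.2 (by omega)).eq_or_lt with rfl | hlk
    · by_cases hvu : v = u
      · subst hvu
        rw [vertexBlock_encodingMatrix_diag, vertexBlock_encodingMatrix_diag]
        exact h1 rfl _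
      · rw [vertexBlock_encodingMatrix_of_ne A l l v u (Or.inr rfl) hvu,
          vertexBlock_encodingMatrix_of_ne B l l v u (Or.inr rfl) hvu]
        exact h0
    · rw [vertexBlock_encodingMatrix_lower A k l v u hlk,
        vertexBlock_encodingMatrix_lower B k l v u hlk]
      exact h0

open RealMatrixRep in
theorem vertexBlock_encodingMatrix_mem_pathSpan (A B : RealMatrixRep V d) (k l : Fin (r + 2))
    (v u : V) :
    (vertexBlock (encodingMatrix c g A) k v l u, vertexBlock (encodingMatrix c g B) k v l u) ∈
      pathSpan (V := Quiver.Symmetrify V) A.double B.double 1 u v := by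
  refine vertexBlock_encodingMatrix_cases A B k l v u
    (· ∈ pathSpan (V := Quiver.Symmetrify V) A.double B.double 1 u v) (zero_mem _) ?_ ?_
  · rintro rfl t
    exact Submodule.smul_mem _ t
      (one_mem_pathSpan (V := Quiver.Symmetrify V) (A := A.double) (B := B.double) 1 u)
  · intro α
    exact mat_mem_pathSpan (V := Quiver.Symmetrify V) (A := A.double) (B := B.double) (Sum.inl α)

open RealMatrixRep in
-- Transposition swaps the two block positions, so an arrow block becomes the block of its
-- companion.
theorem vertexBlock_encodingMatrix_transpose_mem_pathSpan (A B : RealMatrixRep V d)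
    (k l : Fin (r + 2)) (v u : V) :
    (vertexBlock (encodingMatrix c g A)ᵀ k v l u, vertexBlock (encodingMatrix c g B)ᵀ k v l u) ∈
      pathSpan (V := Quiver.Symmetrify V) A.double B.double 1 u v := by
  refine vertexBlock_encodingMatrix_cases A B l k u v
    (fun e => (e.1ᵀ, e.2ᵀ) ∈ pathSpan (V := Quiver.Symmetrify V) A.double B.double 1 u v)
    (zero_mem _) ?_ ?_
  · rintro rfl t
    simp only [transpose_smul, transpose_one]
    exact Submodule.smul_mem _ t
      (one_mem_pathSpan (V := Quiver.Symmetrify V) (A := A.double) (B := B.double) 1 v)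
  · intro α
    exact mat_mem_pathSpan (V := Quiver.Symmetrify V) (A := A.double) (B := B.double) (Sum.inr α)

variable [Fintype V]

-- Each letter contributes at most one arrow, and block multiplication concatenates walks. Working
-- with pairs records that the coefficients are the same for `A` and `B`.
open RealMatrixRep in
theorem vertexBlock_transposeWord_mem_pathSpan (A B : RealMatrixRep V d) (s : FreeMonoid (Fin 2)) :
    ∀ (k l : Fin (r + 2)) (v u : V),
      (vertexBlock (transposeWord (encodingMatrix c g A) s) k v l u,
        vertexBlock (transposeWord (encodingMatrix c g B) s) k v l u) ∈
      pathSpan (V := Quiver.Symmetrify V) A.double B.double s.length u v := by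
  induction s with
  | one =>
    intro k l v u
    by_cases h : (k, v) = (l, u)
    · obtain ⟨rfl, rfl⟩ := Prod.mk.inj h
      have h1 : vertexBlock (1 : Matrix (EncodingIndex d r) (EncodingIndex d r) ℝ) k v k v = 1 := by
        ext i j
        by_cases hij : i = j <;> simp [vertexBlock, Matrix.one_apply, hij]
      rw [map_one, map_one, h1]
      exact one_mem_pathSpan (V := Quiver.Symmetrify V) (A := A.double) (B := B.double) _ v
    · have h1 : vertexBlock (1 : Matrix (EncodingIndex d r) (EncodingIndex d r) ℝ) k v l u = 0 := by
        ext i j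
        refine Matrix.one_apply_ne fun e => h ?_
        exact congrArg (fun p : EncodingIndex d r => (p.1, p.2.1)) e
      rw [map_one, map_one, h1]
      exact zero_mem _
  | of i =>
    intro k l v u
    fin_cases i
    · change (vertexBlock (transposeWord _ (FreeMonoid.of 0)) k v l u,
        vertexBlock (transposeWord _ (FreeMonoid.of 0)) k v l u) ∈ _
      rw [transposeWord_of_zero, transposeWord_of_zero]
      exact vertexBlock_encodingMatrix_mem_pathSpan A B k l v u
    · change (vertexBlock (transposeWord _ (FreeMonoid.of 1)) k v l u,
        vertexBlock (transposeWord _ (FreeMonoid.of 1)) k v l u) ∈ _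
      rw [transposeWord_of_one, transposeWord_of_one]
      exact vertexBlock_encodingMatrix_transpose_mem_pathSpan A B k l v u
  | mul s t hs ht =>
    intro k l v u
    rw [map_mul, map_mul, vertexBlock_mul, vertexBlock_mul, FreeMonoid.length_mul]
    have hsum : (∑ m, ∑ x, vertexBlock (transposeWord (encodingMatrix c g A) s) k v m x *
          vertexBlock (transposeWord (encodingMatrix c g A) t) m x l u,
        ∑ m, ∑ x, vertexBlock (transposeWord (encodingMatrix c g B) s) k v m x *
          vertexBlock (transposeWord (encodingMatrix c g B) t) m x l u) =
        ∑ m, ∑ x, (vertexBlock (transposeWord (encodingMatrix c g A) s) k v m x *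
          vertexBlock (transposeWord (encodingMatrix c g A) t) m x l u,
          vertexBlock (transposeWord (encodingMatrix c g B) s) k v m x *
          vertexBlock (transposeWord (encodingMatrix c g B) t) m x l u) := by
      ext1 <;> simp [Prod.fst_sum, Prod.snd_sum]
    rw [hsum]
    exact sum_mem fun m _ => sum_mem fun x _ =>
      mul_mem_pathSpan (V := Quiver.Symmetrify V) (ht m l x u) (hs k m v x)

/-- Equality of the traces on cycles of bounded length gives equality of the traces of words of
bounded length in the encoding matrices and their transposes. -/
theorem trace_transposeWord_encodingMatrix_eq {A B : RealMatrixRep V d} {s : FreeMonoid (Fin 2)}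
    (h : ∀ π : OrientedCycle (Quiver.Symmetrify V), π.length ≤ s.length →
      A.double.cycleTrace π = B.double.cycleTrace π) :
    (transposeWord (encodingMatrix c g A) s).trace =
      (transposeWord (encodingMatrix c g B) s).trace := by
  rw [trace_eq_sum_vertexBlock, trace_eq_sum_vertexBlock]
  refine Finset.sum_congr rfl fun k _ => Finset.sum_congr rfl fun v _ => ?_
  exact RealMatrixRep.trace_eq_of_mem_pathSpan (V := Quiver.Symmetrify V) h
    (vertexBlock_transposeWord_mem_pathSpan A B s k k v v)

/-- Orthogonally similar encoding matrices belong to orthogonally isometric representations. -/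
theorem orthogonallyIsometric_of_encodingMatrix {A B : RealMatrixRep V d}
    (hc : Function.Injective c)
    (hg : ∀ (a b : V) (α : a ⟶ b), ∃ k l, k + 1 < l ∧ l < r + 2 ∧ g a b k l = some α)
    {W : Matrix (EncodingIndex d r) (EncodingIndex d r) ℝ} (hW : Wᵀ * W = 1)
    (h : W * encodingMatrix c g A = encodingMatrix c g B * W) : A.OrthogonallyIsometric B := by
  have hdiag : ∀ k v l u, (k, v) ≠ (l, u) → vertexBlock W k v l u = 0 := by
    intro k v l u hne
    ext i j
    refine orthogonal_intertwiner_apply_eq_zero (k := fun p : EncodingIndex d r => (p.1 : ℕ))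
      (c := fun p => c (p.1, p.2.1)) ?_ (encodingMatrix_apply_eq_zero A)
      (encodingMatrix_apply_self A) (encodingMatrix_apply_eq_zero B)
      (encodingMatrix_apply_self B) hW h (k, ⟨v, i⟩) (l, ⟨u, j⟩) (fun e => hne (hc e))
    intro p q e
    exact congrArg (fun z => (z.1 : ℕ)) (hc e)
  have hblock : ∀ k v l u, vertexBlock W k v k v * vertexBlock (encodingMatrix c g A) k v l u =
      vertexBlock (encodingMatrix c g B) k v l u * vertexBlock W l u l u := by
    intro k v l u
    rw [← vertexBlock_mul_of_left hdiag, ← vertexBlock_mul_of_right hdiag, h]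
  -- The superdiagonal identities equate the diagonal blocks of `W` at consecutive levels.
  have hconst : ∀ (v : V) (m : ℕ) (hm : m < r + 2),
      vertexBlock W ⟨m, hm⟩ v ⟨m, hm⟩ v = vertexBlock W 0 v 0 v := by
    intro v m
    induction m with
    | zero => intro hm; rfl
    | succ m ih =>
      intro hm
      rw [← ih (by omega)]
      have := hblock ⟨m, by omega⟩ v ⟨m + 1, hm⟩ v
      rwa [vertexBlock_encodingMatrix_super _ _ _ _ rfl,
        vertexBlock_encodingMatrix_super _ _ _ _ rfl, Matrix.mul_one, Matrix.one_mul, eq_comm] at this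
  rw [RealMatrixRep.orthogonallyIsometric_iff]
  refine ⟨fun v => vertexBlock W 0 v 0 v, fun v => ?_, fun a b α => ?_⟩
  · have h1 : vertexBlock (Wᵀ * W) 0 v 0 v = (vertexBlock W 0 v 0 v)ᵀ * vertexBlock W 0 v 0 v :=
      vertexBlock_mul_of_right hdiag 0 v 0 v
    rw [← h1, hW]
    ext i j
    by_cases hij : i = j <;> simp [vertexBlock, Matrix.one_apply, hij]
  · obtain ⟨k, l, hkl, hl, hα⟩ := hg a b α
    have := hblock ⟨k, by omega⟩ b ⟨l, hl⟩ a
    rwa [vertexBlock_encodingMatrix_upper _ _ _ _ _ hkl,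
      vertexBlock_encodingMatrix_upper _ _ _ _ _ hkl, hα, hconst b k, hconst a l] at this

end Encoding

/-! ### From complex word-length bounds to real word traces -/

section Complexification

variable {I : Type*} [Fintype I] [DecidableEq I]

/-- A real square matrix as a complex matrix indexed by an initial segment of the natural
numbers. -/
noncomputable def complexFinMatrix :
    Matrix I I ℝ →* Matrix (Fin (Fintype.card I)) (Fin (Fintype.card I)) ℂ :=
  (Complex.ofRealHom.mapMatrix.comp
    (reindexRingEquiv ℝ (Fintype.equivFin I)).toRingHom : Matrix I I ℝ →+* _)

theorem complexFinMatrix_transpose (X : Matrix I I ℝ) :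
    complexFinMatrix Xᵀ = (complexFinMatrix X)ᴴ := by
  ext i j
  simp [complexFinMatrix]

theorem trace_complexFinMatrix (X : Matrix I I ℝ) :
    (complexFinMatrix X).trace = (X.trace : ℂ) := by
  simp only [complexFinMatrix, Matrix.trace, Matrix.diag]
  push_cast
  exact Fintype.sum_equiv (Fintype.equivFin I).symm _ _ fun i => by simp

theorem lift_complexFinMatrix (X : Matrix I I ℝ) (s : FreeMonoid (Fin 2)) :
    FreeMonoid.lift ![complexFinMatrix X, (complexFinMatrix X)ᴴ] s =
      complexFinMatrix (transposeWord X s) := by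
  induction s with
  | one => simp
  | of i => fin_cases i <;> simp [transposeWord, complexFinMatrix_transpose]
  | mul s t hs ht => rw [map_mul, map_mul, map_mul, hs, ht]

theorem trace_lift_eq_of_unitary_conj {n : Type*} [Fintype n] [DecidableEq n]
    {A B U : Matrix n n ℂ} (hU : U ∈ unitaryGroup n ℂ) (h : B = U⁻¹ * A * U)
    (s : FreeMonoid (Fin 2)) :
    (FreeMonoid.lift ![A, Aᴴ] s).trace = (FreeMonoid.lift ![B, Bᴴ] s).trace := by
  have hU1 : U * Uᴴ = 1 := mem_unitaryGroup_iff.1 hU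
  have hU2 : Uᴴ * U = 1 := mem_unitaryGroup_iff'.1 hU
  rw [inv_eq_right_inv hU1] at h
  have hs : FreeMonoid.lift ![B, Bᴴ] s = Uᴴ * FreeMonoid.lift ![A, Aᴴ] s * U := by
    induction s with
    | one => simp [hU2]
    | of i => fin_cases i <;> simp [h, mul_assoc]
    | mul s t hs ht =>
      rw [map_mul, map_mul, hs, ht]
      calc Uᴴ * FreeMonoid.lift ![A, Aᴴ] s * U * (Uᴴ * FreeMonoid.lift ![A, Aᴴ] t * U)
          = Uᴴ * FreeMonoid.lift ![A, Aᴴ] s * (U * Uᴴ) * FreeMonoid.lift ![A, Aᴴ] t * U := by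
            simp only [mul_assoc]
        _ = _ := by rw [hU1]; simp only [mul_assoc, mul_one]
  rw [hs, trace_mul_cycle, hU1, one_mul]

/-- If a word length suffices in Specht's criterion, the traces of the words up to this length
determine the traces of all words. -/
theorem trace_transposeWord_eq_of_spechtLengthSuffices {X Y : Matrix I I ℝ} {L : ℝ}
    (hL : SpechtLengthSuffices (Fintype.card I) L)
    (h : ∀ s : FreeMonoid (Fin 2), (s.length : ℝ) ≤ L →
      (transposeWord X s).trace = (transposeWord Y s).trace) (s : FreeMonoid (Fin 2)) :
    (transposeWord X s).trace = (transposeWord Y s).trace := by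
  obtain ⟨U, hU, hXY⟩ := hL (complexFinMatrix X) (complexFinMatrix Y) fun s hs => by
    rw [lift_complexFinMatrix, lift_complexFinMatrix, trace_complexFinMatrix,
      trace_complexFinMatrix, h s hs]
  -- Unitary similarity is used only to recover the traces of words of arbitrary length.
  have := trace_lift_eq_of_unitary_conj hU hXY s
  rw [lift_complexFinMatrix, lift_complexFinMatrix, trace_complexFinMatrix,
    trace_complexFinMatrix] at this
  exact_mod_cast this

end Complexification

/-! ### The criterion for matrix representations -/

namespace RealMatrixRep

variable {V : Type u} [Quiver.{w + 1} V] [Fintype V] [∀ a b : V, Finite (a ⟶ b)] {d : V → ℕ}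

/-- The hypothesis `h` isolates the one point where the bounded and unbounded criteria differ:
passing from words controlled by cycle traces to all words. It quantifies over the encoding `M`
because scalars and arrow placement are chosen only inside the proof. -/
theorem orthogonallyIsometric_of_trace_word_eq [DecidableEq V] {A B : RealMatrixRep V d} {r : ℕ}
    (hr : ∀ a b : V, Nat.card (a ⟶ b) ≤ r * (r + 1) / 2)
    (h : ∀ M : RealMatrixRep V d → Matrix (EncodingIndex d r) (EncodingIndex d r) ℝ,
      (∀ s : FreeMonoid (Fin 2),
        (∀ π : OrientedCycle (Quiver.Symmetrify V), π.length ≤ s.length →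
          A.double.cycleTrace π = B.double.cycleTrace π) →
        (transposeWord (M A) s).trace = (transposeWord (M B) s).trace) →
      ∀ s, (transposeWord (M A) s).trace = (transposeWord (M B) s).trace) :
    A.OrthogonallyIsometric B := by
  obtain ⟨g, hg⟩ := exists_arrow_placement hr
  -- Any pairwise distinct real scalars would do; an enumeration of the blocks supplies them.
  let c : Fin (r + 2) × V → ℝ := fun p => (Fintype.equivFin _ p : ℕ)
  have hc : Function.Injective c := fun p q hpq =>
    (Fintype.equivFin _).injective (Fin.ext (Nat.cast_injective hpq))
  obtain ⟨W, hW, hWAB⟩ := exists_orthogonal_intertwiner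
    (h (encodingMatrix c g) fun s hs => trace_transposeWord_encodingMatrix_eq hs)
  exact orthogonallyIsometric_of_encodingMatrix hc hg hW hWAB

theorem orthogonallyIsometric_iff_cycleTrace_eq (A B : RealMatrixRep V d) :
    A.OrthogonallyIsometric B ↔
      ∀ π : OrientedCycle (Quiver.Symmetrify V), A.double.cycleTrace π = B.double.cycleTrace π := by
  classical
  refine ⟨fun h => h.cycleTrace_double_eq, fun h => ?_⟩
  obtain ⟨r, hr⟩ : ∃ r, ∀ a b : V, Nat.card (a ⟶ b) ≤ r := by
    refine ⟨∑ a : V, ∑ b : V, Nat.card (a ⟶ b), fun a b => ?_⟩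
    exact (Finset.single_le_sum (f := fun b => Nat.card (a ⟶ b)) (fun _ _ => Nat.zero_le _)
      (Finset.mem_univ b)).trans (Finset.single_le_sum
        (f := fun a => ∑ b : V, Nat.card (a ⟶ b)) (fun _ _ => Nat.zero_le _) (Finset.mem_univ a))
  -- Without a length bound the size of the encoding is irrelevant, so a crude `r` is enough.
  have hr' : r ≤ r * (r + 1) / 2 := by
    rw [Nat.le_div_iff_mul_le two_pos]
    rcases Nat.eq_zero_or_pos r with rfl | h0
    · simp
    · exact Nat.mul_le_mul_left r (by omega)
  exact orthogonallyIsometric_of_trace_word_eq (fun a b => (hr a b).trans hr')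
    fun M hM s => hM s fun π _ => h π

theorem orthogonallyIsometric_iff_cycleTrace_eq_of_length_le {φ : ℕ → ℝ}
    (hφ : ∀ n : ℕ, 2 ≤ n → SpechtLengthSuffices n (φ n)) {r : ℕ}
    (hr : ∀ a b : V, Nat.card (a ⟶ b) ≤ r * (r + 1) / 2) (A B : RealMatrixRep V d) :
    A.OrthogonallyIsometric B ↔ ∀ π : OrientedCycle (Quiver.Symmetrify V),
      (π.length : ℝ) ≤ φ ((r + 2) * ∑ v : V, d v) →
        A.double.cycleTrace π = B.double.cycleTrace π := by
  refine ⟨fun h π _ => h.cycleTrace_double_eq π, fun h => ?_⟩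
  rcases Nat.eq_zero_or_pos (∑ v : V, d v) with h0 | h0
  -- In total dimension zero the encoding has size `0 < 2`, where `φ` gives no information; but all
  -- matrices are empty.
  · have hd : ∀ v, IsEmpty (Fin (d v)) := fun v => by
      rw [Finset.sum_eq_zero_iff.1 h0 v (Finset.mem_univ v)]
      infer_instance
    exact (orthogonallyIsometric_iff A B).2
      ⟨fun v => 1, fun v => Subsingleton.elim _ _, fun a b α => Subsingleton.elim _ _⟩
  · classical
    have hcard : Fintype.card (EncodingIndex d r) = (r + 2) * ∑ v : V, d v := by simp
    have hn : 2 ≤ (r + 2) * ∑ v : V, d v := by nlinarith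
    refine orthogonallyIsometric_of_trace_word_eq hr fun M hM => ?_
    refine trace_transposeWord_eq_of_spechtLengthSuffices (L := φ ((r + 2) * ∑ v : V, d v))
      (by rw [hcard]; exact hφ _ hn) fun s hs => ?_
    exact hM s fun π hπ => h π ((Nat.cast_le.2 hπ).trans hs)

end RealMatrixRep

/-! ### Euclidean representations in orthonormal bases -/

namespace EuclideanRep

section

variable {V : Type u} [Quiver.{w + 1} V] {d : V → ℕ}

/-- The matrix representation of a Euclidean representation in orthonormal bases. -/
noncomputable def toRealMatrixRep (A : EuclideanRep.{u, w, x} V)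
    (b : ∀ v, OrthonormalBasis (Fin (d v)) ℝ (A.space v)) : RealMatrixRep V d where
  mat {a c} α := LinearMap.toMatrix (b a).toBasis (b c).toBasis (A.map α)

theorem toRealMatrixRep_along (A : EuclideanRep.{u, w, x} V)
    (b : ∀ v, OrthonormalBasis (Fin (d v)) ℝ (A.space v)) {a c : V} (p : Quiver.Path a c) :
    (A.toRealMatrixRep b).along p =
      LinearMap.toMatrix (b a).toBasis (b c).toBasis (A.along p) := by
  induction p with
  | nil => exact (LinearMap.toMatrix_id _).symm
  | cons p α ih =>
    rw [along, RealMatrixRep.along, ih,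
      LinearMap.toMatrix_comp (b a).toBasis (b _).toBasis (b _).toBasis]
    rfl

theorem toRealMatrixRep_cycleTrace (A : EuclideanRep.{u, w, x} V)
    (b : ∀ v, OrthonormalBasis (Fin (d v)) ℝ (A.space v)) (π : OrientedCycle V) :
    (A.toRealMatrixRep b).cycleTrace π = A.cycleTrace π := by
  rw [RealMatrixRep.cycleTrace, cycleTrace, toRealMatrixRep_along,
    ← LinearMap.trace_eq_matrix_trace]

/-- Orthonormality of the bases makes the matrix of the adjoint the transpose. -/
theorem toRealMatrixRep_double (A : EuclideanRep.{u, w, x} V)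
    (b : ∀ v, OrthonormalBasis (Fin (d v)) ℝ (A.space v)) :
    (A.toRealMatrixRep b).double = toRealMatrixRep (V := Quiver.Symmetrify V) A.double b := by
  have h : ∀ (a c : V) (α : c ⟶ a), (LinearMap.toMatrix (b c).toBasis (b a).toBasis (A.map α))ᵀ =
      LinearMap.toMatrix (b a).toBasis (b c).toBasis (LinearMap.adjoint (A.map α)) := fun a c α =>
    ((LinearMap.toMatrix_adjoint (b c) (b a) (A.map α)).trans
      (conjTranspose_eq_transpose_of_trivial _)).symm
  refine congrArg RealMatrixRep.mk ?_
  funext a c α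
  rcases α with α | α
  · rfl
  · exact h a c α

theorem toRealMatrixRep_cycleTrace_double (A : EuclideanRep.{u, w, x} V)
    (b : ∀ v, OrthonormalBasis (Fin (d v)) ℝ (A.space v))
    (π : OrientedCycle (Quiver.Symmetrify V)) :
    (A.toRealMatrixRep b).double.cycleTrace π = A.double.cycleTrace π := by
  rw [toRealMatrixRep_double]
  exact toRealMatrixRep_cycleTrace (V := Quiver.Symmetrify V) A.double b π

theorem transpose_toMatrix_mul_toMatrix_eq_one_iff {E F : Type*} [NormedAddCommGroup E]
    [InnerProductSpace ℝ E] [FiniteDimensional ℝ E] [NormedAddCommGroup F] [InnerProductSpace ℝ F]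
    [FiniteDimensional ℝ F] {n : ℕ} (b : OrthonormalBasis (Fin n) ℝ E)
    (c : OrthonormalBasis (Fin n) ℝ F) (f : E →ₗ[ℝ] F) :
    (LinearMap.toMatrix b.toBasis c.toBasis f)ᵀ * LinearMap.toMatrix b.toBasis c.toBasis f = 1 ↔
      ∀ z z', inner ℝ (f z) (f z') = inner ℝ z z' := by
  rw [← conjTranspose_eq_transpose_of_trivial, ← LinearMap.toMatrix_adjoint,
    ← LinearMap.toMatrix_comp, ← LinearMap.toMatrix_id b.toBasis,
    (LinearMap.toMatrix b.toBasis b.toBasis).injective.eq_iff]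
  constructor
  · intro h z z'
    rw [← LinearMap.adjoint_inner_left, ← LinearMap.comp_apply, h, LinearMap.id_apply]
  · intro h
    ext z
    refine ext_inner_right ℝ fun z' => ?_
    rw [LinearMap.comp_apply, LinearMap.adjoint_inner_left, h, LinearMap.id_apply]

theorem isometric_iff_orthogonallyIsometric (A : EuclideanRep.{u, w, x} V)
    (B : EuclideanRep.{u, w, y} V) (b : ∀ v, OrthonormalBasis (Fin (d v)) ℝ (A.space v))
    (c : ∀ v, OrthonormalBasis (Fin (d v)) ℝ (B.space v)) :
    A.Isometric B ↔ (A.toRealMatrixRep b).OrthogonallyIsometric (B.toRealMatrixRep c) := by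
  rw [RealMatrixRep.orthogonallyIsometric_iff]
  constructor
  · rintro ⟨φ, hφ⟩
    refine ⟨fun v => LinearMap.toMatrix (b v).toBasis (c v).toBasis
      (φ v).toLinearEquiv.toLinearMap, fun v => ?_, fun a a' α => ?_⟩
    · rw [transpose_toMatrix_mul_toMatrix_eq_one_iff]
      exact (φ v).inner_map_map
    · simp only [toRealMatrixRep]
      rw [← LinearMap.toMatrix_comp, ← LinearMap.toMatrix_comp]
      congr 1
      ext z
      exact hφ a a' α z
  · rintro ⟨W, hW, h⟩
    let f : ∀ v, A.space v →ₗ[ℝ] B.space v := fun v =>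
      Matrix.toLin (b v).toBasis (c v).toBasis (W v)
    have hfW : ∀ v, LinearMap.toMatrix (b v).toBasis (c v).toBasis (f v) = W v := fun v =>
      LinearMap.toMatrix_toLin _ _ _
    have hf : ∀ v z z', inner ℝ (f v z) (f v z') = inner ℝ z z' := fun v => by
      rw [← transpose_toMatrix_mul_toMatrix_eq_one_iff (b v) (c v), hfW, hW]
    have hdim : ∀ v, Module.finrank ℝ (A.space v) = Module.finrank ℝ (B.space v) := fun v => by
      rw [Module.finrank_eq_card_basis (b v).toBasis, Module.finrank_eq_card_basis (c v).toBasis]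
    refine ⟨fun v => ((f v).isometryOfInner (hf v)).toLinearIsometryEquiv (hdim v),
      fun a a' α z => ?_⟩
    have key : f a' ∘ₗ A.map α = B.map α ∘ₗ f a := by
      apply (LinearMap.toMatrix (b a).toBasis (c a').toBasis).injective
      rw [LinearMap.toMatrix_comp (b a).toBasis (b a').toBasis,
        LinearMap.toMatrix_comp (b a).toBasis (c a).toBasis, hfW, hfW]
      exact h a a' α
    exact LinearMap.congr_fun key z

end

end EuclideanRep

theorem corollary1 {V : Type u} [Quiver.{w + 1} V] [Fintype V] [∀ a b : V, Finite (a ⟶ b)] :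
    -- (a) Euclidean representations
    (∀ (A : EuclideanRep.{u, w, x} V) (B : EuclideanRep.{u, w, y} V), A.dim = B.dim →
      (A.Isometric B ↔
        ∀ π : OrientedCycle (Quiver.Symmetrify V), A.double.cycleTrace π = B.double.cycleTrace π)) ∧
    -- (b) real matrix representations
    (∀ (d : V → ℕ) (A B : RealMatrixRep V d),
      (A.OrthogonallyIsometric B ↔
        ∀ π : OrientedCycle (Quiver.Symmetrify V), A.double.cycleTrace π = B.double.cycleTrace π)) ∧
    -- (c) cycles of bounded length suffice in (a) and in (b)
    (∀ φ : ℕ → ℝ, (∀ n : ℕ, 2 ≤ n → SpechtLengthSuffices n (φ n)) →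
      ∀ r : ℕ, IsLeast {s : ℕ | ∀ i j : V, Nat.card (j ⟶ i) ≤ s * (s + 1) / 2} r →
        (∀ (A : EuclideanRep.{u, w, x} V) (B : EuclideanRep.{u, w, y} V), A.dim = B.dim →
          (A.Isometric B ↔
            ∀ π : OrientedCycle (Quiver.Symmetrify V),
              (π.length : ℝ) ≤ φ ((r + 2) * ∑ v : V, A.dim v) →
                A.double.cycleTrace π = B.double.cycleTrace π)) ∧
        (∀ (d : V → ℕ) (A B : RealMatrixRep V d),
          (A.OrthogonallyIsometric B ↔
            ∀ π : OrientedCycle (Quiver.Symmetrify V),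
              (π.length : ℝ) ≤ φ ((r + 2) * ∑ v : V, d v) →
                A.double.cycleTrace π = B.double.cycleTrace π))) := by
  -- Both families are indexed through `A.dim`, so the two matrix representations have the same
  -- type.
  have bases : ∀ (A : EuclideanRep.{u, w, x} V) (B : EuclideanRep.{u, w, y} V), A.dim = B.dim →
      Nonempty ((∀ v, OrthonormalBasis (Fin (A.dim v)) ℝ (A.space v)) ×
        (∀ v, OrthonormalBasis (Fin (A.dim v)) ℝ (B.space v))) := fun A B h =>
    ⟨fun v => stdOrthonormalBasis ℝ (A.space v),
      fun v => (stdOrthonormalBasis ℝ (B.space v)).reindex (finCongr (congrFun h v).symm)⟩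
  refine ⟨fun A B h => ?_, fun d A B => A.orthogonallyIsometric_iff_cycleTrace_eq B,
    fun φ hφ r hr => ⟨fun A B h => ?_, fun d A B =>
      A.orthogonallyIsometric_iff_cycleTrace_eq_of_length_le hφ (fun a b => hr.1 b a) B⟩⟩
  · obtain ⟨b, c⟩ := bases A B h
    rw [A.isometric_iff_orthogonallyIsometric B b c,
      RealMatrixRep.orthogonallyIsometric_iff_cycleTrace_eq]
    simp only [EuclideanRep.toRealMatrixRep_cycleTrace_double]
  · obtain ⟨b, c⟩ := bases A B h
    rw [A.isometric_iff_orthogonallyIsometric B b c,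
      RealMatrixRep.orthogonallyIsometric_iff_cycleTrace_eq_of_length_le hφ (fun a b => hr.1 b a)]
    simp only [EuclideanRep.toRealMatrixRep_cycleTrace_double]
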